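/- **Theorem (law of large numbers for the elephant random walk with random step sizes, diffusive regime).** Let $d\ge 1$ and $0\le p<\frac{2d+1}{4d}$. Let $e_1,\dots,e_d$ be the standard basis of $\mathbb{R}^d$, let $I_d$ be the identity matrix, and let $J_d$ be the $d\times d$ cyclic shift matrix, whose entries are $1$ at the positions $(i,i+1)$, $1\le i<d$, and $(d,1)$, and $0$ elsewhere. On a probability space, let $X_1$ be uniformly distributed on $\{\pm e_1,\dots,\pm e_d\}$ and, for $n\ge 1$, let $$X_{n+1}=A_{n+1}X_{\beta(n)},$$ where $\beta(n)$ is uniform on $\{1,\dots,n\}$ and $A_{n+1}$ is a random matrix which equals $I_d$ with probability $p$ and equals each of $-I_d,\pm J_d,\pm J_d^2,\dots,\pm J_d^{d-1}$ with probability $\frac{1-p}{2d-1}$. Let the step size $Y_1$ be a positive random variable with finite mean and variance, and let $(Y_n)_{n\ge 2}$ be nonnegative i.i.d. random variables with finite mean and variance. Suppose that for every $n\ge 1$ the random variables $A_{n+1}$, $\beta(n)$, $Y_{n+1}$ are mutually independent, and that the triple $(A_{n+1},\beta(n),Y_{n+1})$ is independent of the history $(X_1,\dots,X_n,Y_1,\dots,Y_n)$.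 Let $$S_n=\sum_{k=1}^n T_k,\qquad T_k=X_kY_k .$$ Then, for every $\alpha>\frac12$, $$\lim_{n\to\infty}\frac{S_n}{n^{\alpha}}=0\quad\text{almost surely.}$$ -/

import Mathlib

open MeasureTheory ProbabilityTheory Filter Topology Matrix

noncomputable section

namespace MERW

/-- The `d × d` cyclic shift matrix `J_d`: ones at the entries `(i, i + 1)` and at `(d, 1)`. -/
def shiftMatrix (d : ℕ) : Matrix (Fin d) (Fin d) ℝ :=
  Matrix.of fun i j => if (j : ℕ) = ((i : ℕ) + 1) % d then 1 else 0

instance (d : ℕ) : MeasurableSpace (Matrix (Fin d) (Fin d) ℝ) :=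
  inferInstanceAs (MeasurableSpace (Fin d → Fin d → ℝ))

/-- The law of the random matrices `A_{n+1}`: mass `p` at `I_d`, and mass `(1 - p) / (2 d - 1)`
at each of `-I_d, ± J_d, …, ± J_d ^ (d - 1)`. -/
def matrixLaw (d : ℕ) (p : ℝ) : Measure (Matrix (Fin d) (Fin d) ℝ) :=
  ENNReal.ofReal p • Measure.dirac 1 +
    ENNReal.ofReal ((1 - p) / (2 * d - 1)) •
      (Measure.dirac (-1) +
        ∑ i ∈ Finset.Ico 1 d,
          (Measure.dirac (shiftMatrix d ^ i) + Measure.dirac (-(shiftMatrix d ^ i))))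

/-- The uniform distribution on the `2 d` unit vectors `± e_1, …, ± e_d`. -/
def firstLaw (d : ℕ) : Measure (Fin d → ℝ) :=
  ENNReal.ofReal (1 / (2 * d)) •
    ∑ i : Fin d, (Measure.dirac (Pi.single i (1 : ℝ)) + Measure.dirac (-(Pi.single i (1 : ℝ))))

/-- The unit steps of the elephant random walk, for one realisation of its inputs:
`X_1 = x₁` and `X_{n+1} = A_{n+1} X_{β(n)}` for `n ≥ 1`. The value at `0`, and the value when
`β(n)` lies outside `{0, …, n}` (which has probability zero below), are fillers. -/
def dir {d : ℕ} (x₁ : Fin d → ℝ) (A : ℕ → Matrix (Fin d) (Fin d) ℝ) (β : ℕ → ℕ) :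
    ℕ → (Fin d → ℝ)
  | 0 => 0
  | 1 => x₁
  | n + 2 => if _h : β (n + 1) < n + 2 then A (n + 2) *ᵥ dir x₁ A β (β (n + 1)) else 0

variable {Ω : Type*} {d : ℕ}

/-- The random unit step `X_n`, `n ≥ 1`. -/
def X (X₁ : Ω → Fin d → ℝ) (A : ℕ → Ω → Matrix (Fin d) (Fin d) ℝ) (β : ℕ → Ω → ℕ)
    (n : ℕ) (ω : Ω) : Fin d → ℝ :=
  dir (X₁ ω) (fun k => A k ω) (fun k => β k ω) n

/-- The step `T_n = X_n Y_n`, `n ≥ 1`; that is, `T_1 = X_1 Y_1` and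
`T_{n+1} = A_{n+1} X_{β(n)} Y_{n+1}`. -/
def T (X₁ : Ω → Fin d → ℝ) (A : ℕ → Ω → Matrix (Fin d) (Fin d) ℝ) (β : ℕ → Ω → ℕ)
    (Y : ℕ → Ω → ℝ) (n : ℕ) (ω : Ω) : Fin d → ℝ :=
  Y n ω • X X₁ A β n ω

/-- The position `S_n = T_1 + ⋯ + T_n`. -/
def S (X₁ : Ω → Fin d → ℝ) (A : ℕ → Ω → Matrix (Fin d) (Fin d) ℝ) (β : ℕ → Ω → ℕ)
    (Y : ℕ → Ω → ℝ) (n : ℕ) (ω : Ω) : Fin d → ℝ :=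
  ∑ k ∈ Finset.Icc 1 n, T X₁ A β Y k ω

/-- The random inputs `X_1`, `(A_n)_{n ≥ 2}`, `(β(n))_{n ≥ 1}`, `(Y_n)_{n ≥ 1}` drive a
multidimensional elephant random walk with random step sizes and memory parameter `p`. -/
structure IsInput [MeasurableSpace Ω] (P : Measure Ω) (p : ℝ) (X₁ : Ω → Fin d → ℝ)
    (A : ℕ → Ω → Matrix (Fin d) (Fin d) ℝ) (β : ℕ → Ω → ℕ) (Y : ℕ → Ω → ℝ) : Prop where
  measurable_first : Measurable X₁
  measurable_matrix : ∀ n, 2 ≤ n → Measurable (A n)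
  measurable_memory : ∀ n, 1 ≤ n → Measurable (β n)
  measurable_size : ∀ n, 1 ≤ n → Measurable (Y n)
  /-- `X_1` is uniform on `{± e_1, …, ± e_d}`. -/
  law_first : P.map X₁ = firstLaw d
  law_matrix : ∀ n, 2 ≤ n → P.map (A n) = matrixLaw d p
  /-- `β(n)` is uniform on `{1, …, n}`. -/
  law_memory : ∀ n, 1 ≤ n → P.map (β n) = uniformOn (Set.Icc 1 n)
  /-- `Y_1` is positive, with finite mean and variance. -/
  first_size_pos : ∀ᵐ ω ∂P, 0 < Y 1 ω
  first_size_memLp : MemLp (Y 1) 2 P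
  /-- `(Y_n)_{n ≥ 2}` are nonnegative and iid, with finite mean and variance. -/
  size_nonneg : ∀ n, 2 ≤ n → ∀ᵐ ω ∂P, 0 ≤ Y n ω
  size_memLp : ∀ n, 2 ≤ n → MemLp (Y n) 2 P
  size_identDistrib : ∀ n, 2 ≤ n → IdentDistrib (Y n) (Y 2) P P
  size_indep : iIndepFun (fun n => Y (n + 2)) P
  /-- `A_{n+1}`, `β(n)` and `Y_{n+1}` are (mutually) independent: the first is independent of the
  other two, and these are independent of each other. -/
  indep_matrix : ∀ n, 1 ≤ n → IndepFun (A (n + 1)) (fun ω => (β n ω, Y (n + 1) ω)) P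
  indep_memory_size : ∀ n, 1 ≤ n → IndepFun (β n) (Y (n + 1)) P
  /-- `(A_{n+1}, β(n), Y_{n+1})` is independent of the history `X_1, Y_1, …, X_n, Y_n`. -/
  indep_history : ∀ n, 1 ≤ n →
    IndepFun (fun ω => (A (n + 1) ω, β n ω, Y (n + 1) ω))
      (fun ω (k : Finset.Icc 1 n) => (X X₁ A β k ω, Y k ω)) P

end MERW

end

/-!
The law of `A_{n+1}` gives mass to `±J_d ^ k` in cancelling pairs, so `E[A_{n+1}] = a • 1` with
`a = (2dp - 1) / (2d - 1)`, and `a < 1/2` exactly when `p < (2d + 1) / (4d)`. Let `V_n` be the sum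
of `X_1, …, X_n`. Since the memory `β(n)` is uniform, the conditional means of `X_{n+1}` and
`T_{n+1}` given the history are `(a / n) V_n` and `(a E[Y_{n+1}] / n) V_n`. The first formula yields
a recursive inequality for the second moments of the coordinates of `V_n`, by which they are
`O(n ^ (2γ))` for every `γ > max(1/2, a)`.

Write `T_{n+1}` as its conditional mean plus a martingale difference bounded in `L²`. The martingale
differences, weighted by `n ^ (-α)` with `α > 1/2`, form an almost surely convergent series. So do
the weighted conditional means, which are summable in `L¹` because `E|V_n| / n = O(n ^ (γ - 1))`
with `γ < α`. Kronecker's lemma turns both into the convergence of `S_n / n ^ α` to `0`.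
-/

section RealSequences

theorem tendsto_inv_mul_sum_range_sub_mul {b u : ℕ → ℝ} {l : ℝ} (hb : Monotone b)
    (hb_top : Tendsto b atTop atTop) (hu : Tendsto u atTop (𝓝 l)) :
    Tendsto (fun n => (b n)⁻¹ * ∑ k ∈ Finset.range n, (b (k + 1) - b k) * u k) atTop (𝓝 l) := by
  have hb_inv : Tendsto (fun n => (b n)⁻¹) atTop (𝓝 0) := tendsto_inv_atTop_zero.comp hb_top
  have hb_sub : Tendsto (fun n => b n - b 0) atTop atTop :=
    tendsto_atTop_add_const_right _ _ hb_top
  have htelescope : ∀ n, ∑ k ∈ Finset.range n, (b (k + 1) - b k) = b n - b 0 :=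
    Finset.sum_range_sub b
  have hcentred : Tendsto
      (fun n => (b n)⁻¹ * ∑ k ∈ Finset.range n, (b (k + 1) - b k) * (u k - l)) atTop (𝓝 0) := by
    have hterm : (fun k => (b (k + 1) - b k) * (u k - l)) =o[atTop] fun k => b (k + 1) - b k := by
      simpa using (Asymptotics.isBigO_refl (fun k => b (k + 1) - b k) atTop).mul_isLittleO
        ((Asymptotics.isLittleO_one_iff ℝ).2 (by simpa using hu.sub_const l))
    have hsum := hterm.sum_range (fun k => sub_nonneg.2 (hb k.le_succ))
      (by simpa only [htelescope] using hb_sub)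
    simp only [htelescope] at hsum
    have hsub : (fun n => b n - b 0) =O[atTop] b :=
      (Asymptotics.isBigO_refl b atTop).sub (Asymptotics.isLittleO_const_left.2
        (Or.inr (tendsto_norm_atTop_atTop.comp hb_top))).isBigO
    simpa only [div_eq_inv_mul] using (hsum.trans_isBigO hsub).tendsto_div_nhds_zero
  have hlim := (hcentred.add_const l).sub (hb_inv.mul_const (b 0 * l))
  rw [zero_add, zero_mul, sub_zero] at hlim
  refine hlim.congr' ?_
  filter_upwards [hb_top.eventually_gt_atTop 0] with n hn
  simp only [mul_sub, Finset.sum_sub_distrib, ← Finset.sum_mul, htelescope]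
  field_simp
  ring

/-- **Kronecker's lemma**. -/
theorem tendsto_inv_mul_sum_range_mul_of_tendsto_sum {b x : ℕ → ℝ} {s : ℝ} (hb : Monotone b)
    (hb_top : Tendsto b atTop atTop)
    (hx : Tendsto (fun n => ∑ k ∈ Finset.range n, x k) atTop (𝓝 s)) :
    Tendsto (fun n => (b n)⁻¹ * ∑ k ∈ Finset.range n, b (k + 1) * x k) atTop (𝓝 0) := by
  set σ : ℕ → ℝ := fun n => ∑ k ∈ Finset.range n, x k with hσ
  have hparts : ∀ n, ∑ k ∈ Finset.range n, b (k + 1) * x k =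
      b n * σ n - ∑ k ∈ Finset.range n, (b (k + 1) - b k) * σ k := fun n => by
    induction n with
    | zero => simp [hσ]
    | succ n ih =>
      rw [Finset.sum_range_succ, ih, Finset.sum_range_succ, hσ]
      simp only [Finset.sum_range_succ]
      ring
  have hlim := hx.sub (tendsto_inv_mul_sum_range_sub_mul hb hb_top hx)
  rw [sub_self] at hlim
  refine hlim.congr' ?_
  filter_upwards [hb_top.eventually_gt_atTop 0] with n hn
  rw [hparts, mul_sub, inv_mul_cancel_left₀ hn.ne']

theorem tendsto_inv_rpow_mul_sum_range_of_tendsto_sum {y : ℕ → ℝ} {α s : ℝ} (hα : 0 < α)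
    (hy : Tendsto (fun n => ∑ k ∈ Finset.range n, (((k + 1 : ℕ) : ℝ) ^ α)⁻¹ * y k) atTop (𝓝 s)) :
    Tendsto (fun n : ℕ => ((n : ℝ) ^ α)⁻¹ * ∑ k ∈ Finset.range n, y k) atTop (𝓝 0) := by
  have hmono : Monotone fun n : ℕ => (n : ℝ) ^ α := fun m n hmn =>
    Real.rpow_le_rpow m.cast_nonneg (Nat.cast_le.2 hmn) hα.le
  have htop : Tendsto (fun n : ℕ => (n : ℝ) ^ α) atTop atTop :=
    (tendsto_rpow_atTop hα).comp tendsto_natCast_atTop_atTop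
  have hpos : ∀ k : ℕ, ((k + 1 : ℕ) : ℝ) ^ α ≠ 0 := fun k => by positivity
  simpa only [mul_inv_cancel_left₀ (hpos _)] using
    tendsto_inv_mul_sum_range_mul_of_tendsto_sum hmono htop hy

/-- The gap `κ - c > 0` pays for `R`: Bernoulli's inequality gives
`(n + 1) ^ κ ≥ (1 + κ / n) * n ^ κ`, and `n ^ κ / n ≥ 1`. -/
theorem exists_le_mul_rpow_of_succ_le {v : ℕ → ℝ} {c κ R : ℝ} (hc : 0 ≤ c) (hcκ : c < κ)
    (hκ : 1 ≤ κ) (hv₁ : v 1 ≤ R)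
    (hv : ∀ n : ℕ, 1 ≤ n → v (n + 1) ≤ (1 + c / n) * v n + R) :
    ∃ C : ℝ, 0 ≤ C ∧ ∀ n : ℕ, 1 ≤ n → v n ≤ C * (n : ℝ) ^ κ := by
  refine ⟨max |R| (|R| / (κ - c)), le_max_of_le_left (abs_nonneg R), fun n hn => ?_⟩
  set C := max |R| (|R| / (κ - c))
  have hC : 0 ≤ C := le_max_of_le_left (abs_nonneg R)
  have hRC : R ≤ C * (κ - c) := (le_abs_self R).trans <|
    (div_le_iff₀ (sub_pos.2 hcκ)).1 (le_max_right _ _)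
  induction n, hn using Nat.le_induction with
  | base =>
    rw [Nat.cast_one, Real.one_rpow, mul_one]
    exact hv₁.trans ((le_abs_self R).trans (le_max_left _ _))
  | succ n hn ih =>
    have hn₁ : (1 : ℝ) ≤ n := Nat.one_le_cast.2 hn
    have hn₀ : (0 : ℝ) < n := by linarith
    have hbernoulli : (1 + κ / n) * (n : ℝ) ^ κ ≤ ((n + 1 : ℕ) : ℝ) ^ κ := by
      have hfactor : ((n + 1 : ℕ) : ℝ) = (1 + 1 / n) * n := by push_cast; field_simp
      rw [hfactor, Real.mul_rpow (by positivity) hn₀.le]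
      gcongr
      simpa [div_eq_mul_inv] using
        one_add_mul_self_le_rpow_one_add (s := 1 / (n : ℝ)) (by linarith [one_div_pos.2 hn₀]) hκ
    have hpow : 1 ≤ (n : ℝ) ^ κ / n := by
      rw [one_le_div hn₀]
      simpa using Real.rpow_le_rpow_of_exponent_le hn₁ hκ
    calc v (n + 1) ≤ (1 + c / n) * (C * (n : ℝ) ^ κ) + C * (κ - c) := by
          refine (hv n hn).trans ?_
          gcongr
      _ ≤ (1 + c / n) * (C * (n : ℝ) ^ κ) + C * (κ - c) * ((n : ℝ) ^ κ / n) := by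
          exact add_le_add_right
            (le_mul_of_one_le_right (mul_nonneg hC (sub_pos.2 hcκ).le) hpow) _
      _ = C * ((1 + κ / n) * (n : ℝ) ^ κ) := by ring
      _ ≤ C * ((n + 1 : ℕ) : ℝ) ^ κ := by gcongr

end RealSequences

section MeasureSpace

variable {Ω : Type*} {m₀ : MeasurableSpace Ω} {μ : Measure Ω}

theorem ae_summable_of_summable_integral_norm {E : Type*} [NormedAddCommGroup E]
    [CompleteSpace E] {f : ℕ → Ω → E} (hf : ∀ n, Integrable (f n) μ)
    (hsum : Summable fun n => ∫ ω, ‖f n ω‖ ∂μ) : ∀ᵐ ω ∂μ, Summable fun n => f n ω := by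
  have hmeas : ∀ n, AEMeasurable (fun ω => ‖f n ω‖ₑ) μ := fun n => (hf n).1.enorm
  have hfin : ∫⁻ ω, ∑' n, ‖f n ω‖ₑ ∂μ ≠ ⊤ := by
    rw [lintegral_tsum hmeas]
    simp only [← ofReal_integral_norm_eq_lintegral_enorm (hf _)]
    exact hsum.tsum_ofReal_ne_top
  filter_upwards [ae_lt_top' (AEMeasurable.tsum hmeas) hfin] with ω hω
  exact Summable.of_norm (by simpa using ENNReal.summable_toReal hω.ne)

theorem integral_add_sq {f g : Ω → ℝ} (hf : MemLp f 2 μ) (hg : MemLp g 2 μ) :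
    ∫ ω, (f ω + g ω) ^ 2 ∂μ =
      ∫ ω, f ω ^ 2 ∂μ + 2 * ∫ ω, f ω * g ω ∂μ + ∫ ω, g ω ^ 2 ∂μ := by
  have hfg : Integrable (fun ω => 2 * (f ω * g ω)) μ := (hf.integrable_mul hg).const_mul 2
  have hsum : Integrable (fun ω => f ω ^ 2 + 2 * (f ω * g ω)) μ := hf.integrable_sq.add hfg
  rw [← integral_const_mul, ← integral_add hf.integrable_sq hfg,
    ← integral_add hsum hg.integrable_sq]
  simp only [add_sq, mul_assoc]

theorem integral_abs_le_sqrt_integral_sq [IsProbabilityMeasure μ] {f : Ω → ℝ}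
    (hf : MemLp f 2 μ) : ∫ ω, |f ω| ∂μ ≤ √(∫ ω, f ω ^ 2 ∂μ) := by
  have hvar := variance_nonneg |f| μ
  rw [variance_eq_sub hf.abs] at hvar
  refine Real.le_sqrt_of_sq_le ?_
  simpa using hvar

theorem integral_mul_eq_integral_mul_condExp {m : MeasurableSpace Ω} (hm : m ≤ m₀)
    [SigmaFinite (μ.trim hm)] {f g : Ω → ℝ} (hf : StronglyMeasurable[m] f)
    (hfg : Integrable (f * g) μ) (hg : Integrable g μ) :
    ∫ ω, f ω * g ω ∂μ = ∫ ω, f ω * μ[g | m] ω ∂μ := by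
  rw [← integral_condExp hm (f := fun ω => f ω * g ω)]
  exact integral_congr_ae (condExp_mul_of_stronglyMeasurable_left hf hfg hg)

theorem integral_sub_condExp_sq_le [IsFiniteMeasure μ] {m : MeasurableSpace Ω} (hm : m ≤ m₀)
    {f : Ω → ℝ} (hf : MemLp f 2 μ) :
    ∫ ω, (f ω - μ[f | m] ω) ^ 2 ∂μ ≤ ∫ ω, f ω ^ 2 ∂μ := by
  calc ∫ ω, (f ω - μ[f | m] ω) ^ 2 ∂μ = ∫ ω, Var[f; μ | m] ω ∂μ := (integral_condExp hm).symm
    _ ≤ ∫ ω, μ[f ^ 2 | m] ω ∂μ :=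
        integral_mono_ae integrable_condVar integrable_condExp (condVar_ae_le_condExp_sq hm hf)
    _ = ∫ ω, f ω ^ 2 ∂μ := integral_condExp hm

theorem condExp_sub_condExp_ae_eq_zero [IsFiniteMeasure μ] {m : MeasurableSpace Ω} (hm : m ≤ m₀)
    {f : Ω → ℝ} (hf : Integrable f μ) : μ[f - μ[f | m] | m] =ᵐ[μ] 0 := by
  refine (condExp_sub hf integrable_condExp m).trans ?_
  rw [condExp_of_stronglyMeasurable hm stronglyMeasurable_condExp integrable_condExp, sub_self]

theorem condExp_sum_mul_of_indep [IsFiniteMeasure μ] {ι : Type*} {m₁ m₂ : MeasurableSpace Ω}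
    (hm₁ : m₁ ≤ m₀) (hm₂ : m₂ ≤ m₀) (hindep : Indep m₁ m₂ μ) (s : Finset ι) {f g : ι → Ω → ℝ}
    (hf : ∀ k ∈ s, StronglyMeasurable[m₁] (f k)) (hf_int : ∀ k ∈ s, Integrable (f k) μ)
    (hg : ∀ k ∈ s, StronglyMeasurable[m₂] (g k)) (hg_int : ∀ k ∈ s, Integrable (g k) μ) :
    μ[∑ k ∈ s, f k * g k | m₂] =ᵐ[μ] fun ω => ∑ k ∈ s, (∫ ω', f k ω' ∂μ) * g k ω := by
  have hfg_int : ∀ k ∈ s, Integrable (f k * g k) μ := fun k hk =>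
    IndepFun.integrable_mul (indep_of_indep_of_le_left (indep_of_indep_of_le_right hindep
      (hg k hk).measurable.comap_le) (hf k hk).measurable.comap_le) (hf_int k hk) (hg_int k hk)
  have hterm : ∀ k ∈ s, μ[f k * g k | m₂] =ᵐ[μ] fun ω => (∫ ω', f k ω' ∂μ) * g k ω :=
    fun k hk => by
      filter_upwards [condExp_mul_of_stronglyMeasurable_right (hg k hk) (hfg_int k hk)
        (hf_int k hk), condExp_indep_eq hm₁ hm₂ (hf k hk) hindep] with ω hpull hconst
      rw [hpull, Pi.mul_apply, hconst]
  filter_upwards [condExp_finsetSum hfg_int m₂, (eventually_all_finset s).2 hterm]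
    with ω hsum hω
  rw [hsum, Finset.sum_apply]
  exact Finset.sum_congr rfl hω

end MeasureSpace

section MartingaleDifferences

variable {Ω : Type*} {m₀ : MeasurableSpace Ω} {μ : Measure Ω}
  {ℱ : Filtration ℕ m₀} {D : ℕ → Ω → ℝ}

theorem stronglyMeasurable_sum_range_of_succ
    (hD : ∀ n, StronglyMeasurable[ℱ (n + 1)] (D n)) (n : ℕ) :
    StronglyMeasurable[ℱ n] fun ω => ∑ k ∈ Finset.range n, D k ω :=
  Finset.stronglyMeasurable_fun_sum _ fun k hk =>
    (hD k).mono (ℱ.mono (Finset.mem_range.1 hk))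

theorem martingale_sum_range [IsFiniteMeasure μ] (hD : ∀ n, StronglyMeasurable[ℱ (n + 1)] (D n))
    (hint : ∀ n, Integrable (D n) μ) (hzero : ∀ n, μ[D n | ℱ n] =ᵐ[μ] 0) :
    Martingale (fun n ω => ∑ k ∈ Finset.range n, D k ω) ℱ μ := by
  refine martingale_of_condExp_sub_eq_zero_nat (stronglyMeasurable_sum_range_of_succ hD)
    (fun n => integrable_finsetSum _ fun k _ => hint k) fun n => ?_
  have hincrement : (fun ω => ∑ k ∈ Finset.range (n + 1), D k ω) -
      (fun ω => ∑ k ∈ Finset.range n, D k ω) = D n := by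
    ext ω
    simp [Finset.sum_range_succ]
  rw [hincrement]
  exact hzero n

theorem integral_sum_range_sq [IsFiniteMeasure μ] (hD : ∀ n, StronglyMeasurable[ℱ (n + 1)] (D n))
    (hL2 : ∀ n, MemLp (D n) 2 μ) (hzero : ∀ n, μ[D n | ℱ n] =ᵐ[μ] 0) (n : ℕ) :
    ∫ ω, (∑ k ∈ Finset.range n, D k ω) ^ 2 ∂μ =
      ∑ k ∈ Finset.range n, ∫ ω, D k ω ^ 2 ∂μ := by
  induction n with
  | zero => simp
  | succ n ih =>
    have hsumL2 : MemLp (fun ω => ∑ k ∈ Finset.range n, D k ω) 2 μ :=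
      memLp_finsetSum _ fun k _ => hL2 k
    have horthogonal : ∫ ω, (∑ k ∈ Finset.range n, D k ω) * D n ω ∂μ = 0 := by
      rw [integral_mul_eq_integral_mul_condExp (ℱ.le n)
        (stronglyMeasurable_sum_range_of_succ hD n) (hsumL2.integrable_mul (hL2 n))
        ((hL2 n).integrable one_le_two)]
      refine integral_eq_zero_of_ae ?_
      filter_upwards [hzero n] with ω hω
      simp [hω]
    simp only [Finset.sum_range_succ]
    rw [integral_add_sq hsumL2 (hL2 n), horthogonal, ih, mul_zero, add_zero]

variable [IsProbabilityMeasure μ]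

theorem ae_exists_tendsto_sum_range_of_summable_integral_sq
    (hD : ∀ n, StronglyMeasurable[ℱ (n + 1)] (D n)) (hL2 : ∀ n, MemLp (D n) 2 μ)
    (hzero : ∀ n, μ[D n | ℱ n] =ᵐ[μ] 0) (hsum : Summable fun n => ∫ ω, D n ω ^ 2 ∂μ) :
    ∀ᵐ ω ∂μ, ∃ s, Tendsto (fun n => ∑ k ∈ Finset.range n, D k ω) atTop (𝓝 s) := by
  have hmart := martingale_sum_range hD (fun n => (hL2 n).integrable one_le_two) hzero
  refine hmart.submartingale.exists_ae_tendsto_of_bdd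
    (R := (√(∑' k, ∫ ω, D k ω ^ 2 ∂μ)).toNNReal) fun n => ?_
  rw [eLpNorm_one_eq_lintegral_enorm,
    ← ofReal_integral_norm_eq_lintegral_enorm (hmart.integrable n)]
  refine ENNReal.ofReal_le_ofReal ?_
  calc ∫ ω, |∑ k ∈ Finset.range n, D k ω| ∂μ
      ≤ √(∫ ω, (∑ k ∈ Finset.range n, D k ω) ^ 2 ∂μ) :=
        integral_abs_le_sqrt_integral_sq (memLp_finsetSum _ fun k _ => hL2 k)
    _ ≤ √(∑' k, ∫ ω, D k ω ^ 2 ∂μ) := by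
        rw [integral_sum_range_sq hD hL2 hzero]
        exact Real.sqrt_le_sqrt
          (hsum.sum_le_tsum _ fun k _ => integral_nonneg fun ω => sq_nonneg _)

theorem ae_tendsto_inv_rpow_mul_sum_range_of_condExp_eq_zero
    (hD : ∀ n, StronglyMeasurable[ℱ (n + 1)] (D n)) (hL2 : ∀ n, MemLp (D n) 2 μ)
    (hzero : ∀ n, μ[D n | ℱ n] =ᵐ[μ] 0) {R : ℝ} (hR : ∀ n, ∫ ω, D n ω ^ 2 ∂μ ≤ R)
    {α : ℝ} (hα : 1 / 2 < α) :
    ∀ᵐ ω ∂μ, Tendsto (fun n : ℕ => ((n : ℝ) ^ α)⁻¹ * ∑ k ∈ Finset.range n, D k ω)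
      atTop (𝓝 0) := by
  set c : ℕ → ℝ := fun n => (((n + 1 : ℕ) : ℝ) ^ α)⁻¹ with hc
  have hc_sq : Summable fun n => c n ^ 2 := by
    refine ((summable_nat_add_iff 1).2
      (Real.summable_nat_rpow.2 (by linarith : -(α * 2) < -1))).congr fun n => ?_
    rw [hc, Real.rpow_neg (Nat.cast_nonneg _), Real.rpow_mul (Nat.cast_nonneg _), Real.rpow_two,
      inv_pow]
  have hsum : Summable fun n => ∫ ω, (c n * D n ω) ^ 2 ∂μ := by
    simp only [mul_pow, integral_const_mul]
    exact (hc_sq.mul_right R).of_nonneg_of_le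
      (fun n => mul_nonneg (sq_nonneg _) (integral_nonneg fun ω => sq_nonneg _))
      fun n => mul_le_mul_of_nonneg_left (hR n) (sq_nonneg _)
  have hzero_mul : ∀ n, μ[fun ω => c n * D n ω | ℱ n] =ᵐ[μ] 0 := fun n => by
    filter_upwards [condExp_smul (c n) (D n) (ℱ n), hzero n] with ω hsmul hω
    exact hsmul.trans (by simp [hω])
  filter_upwards [ae_exists_tendsto_sum_range_of_summable_integral_sq
    (fun n => (hD n).const_mul (c n)) (fun n => (hL2 n).const_mul (c n)) hzero_mul hsum]
    with ω ⟨s, hs⟩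
  exact tendsto_inv_rpow_mul_sum_range_of_tendsto_sum (by linarith) hs

end MartingaleDifferences

section ReinforcedSequences

variable {Ω : Type*} {m₀ : MeasurableSpace Ω} {μ : Measure Ω}

theorem ae_tendsto_inv_rpow_mul_sum_range_inv_mul {Z : ℕ → Ω → ℝ} {C γ α : ℝ}
    (hZ : ∀ n, Integrable (Z n) μ) (hC : ∀ n : ℕ, ∫ ω, |Z n ω| ∂μ ≤ C * (n : ℝ) ^ γ)
    (hα : 0 < α) (hγα : γ < α) :
    ∀ᵐ ω ∂μ, Tendsto (fun n : ℕ => ((n : ℝ) ^ α)⁻¹ *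
      ∑ k ∈ Finset.range n, (k : ℝ)⁻¹ * Z k ω) atTop (𝓝 0) := by
  have hsum : Summable fun n : ℕ =>
      ∫ ω, ‖(((n + 1 : ℕ) : ℝ) ^ α)⁻¹ * ((n : ℝ)⁻¹ * Z n ω)‖ ∂μ := by
    refine Summable.of_nonneg_of_le (fun n => integral_nonneg fun ω => norm_nonneg _)
      (fun n => ?_) ((Real.summable_nat_rpow.2 (by linarith : γ - α - 1 < -1)).mul_left |C|)
    rcases n.eq_zero_or_pos with rfl | hn
    · simp only [Nat.cast_zero, _root_.inv_zero, zero_mul, mul_zero, norm_zero, integral_zero]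
      positivity
    have hn₀ : (0 : ℝ) < n := Nat.cast_pos.2 hn
    simp only [norm_mul, norm_inv, Real.norm_eq_abs, Nat.abs_cast, integral_const_mul,
      Real.abs_rpow_of_nonneg (Nat.cast_nonneg (n + 1))]
    calc (((n + 1 : ℕ) : ℝ) ^ α)⁻¹ * ((n : ℝ)⁻¹ * ∫ ω, |Z n ω| ∂μ)
        ≤ ((n : ℝ) ^ α)⁻¹ * ((n : ℝ)⁻¹ * (|C| * (n : ℝ) ^ γ)) := by
          gcongr
          · exact n.le_succ
          · exact (hC n).trans (by gcongr; exact le_abs_self C)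
      _ = |C| * (n : ℝ) ^ (γ - α - 1) := by
          rw [Real.rpow_sub hn₀, Real.rpow_sub hn₀, Real.rpow_one]
          ring
  filter_upwards [ae_summable_of_summable_integral_norm
    (fun n => ((hZ n).const_mul _).const_mul _) hsum] with ω hω
  exact tendsto_inv_rpow_mul_sum_range_of_tendsto_sum hα hω.hasSum.tendsto_sum_nat

variable [IsProbabilityMeasure μ] {ℱ : Filtration ℕ m₀}

/-- The sum of `u` is split into its compensated part, which is handled as a martingale, and the
sum of the conditional means `Z k / k`. At `k = 0` this formula is not available, which leaves a
single bounded term. -/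
theorem ae_tendsto_inv_rpow_mul_sum_range_of_condExp_eq_inv_mul {u Z : ℕ → Ω → ℝ} {R C γ α : ℝ}
    (hu : ∀ n, StronglyMeasurable[ℱ (n + 1)] (u n)) (hL2 : ∀ n, MemLp (u n) 2 μ)
    (hR : ∀ n, ∫ ω, u n ω ^ 2 ∂μ ≤ R) (hZ : ∀ n, Integrable (Z n) μ)
    (hC : ∀ n : ℕ, ∫ ω, |Z n ω| ∂μ ≤ C * (n : ℝ) ^ γ)
    (hmean : ∀ n : ℕ, 1 ≤ n → μ[u n | ℱ n] =ᵐ[μ] fun ω => (n : ℝ)⁻¹ * Z n ω)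
    (hα : 1 / 2 < α) (hγα : γ < α) :
    ∀ᵐ ω ∂μ, Tendsto (fun n : ℕ => ((n : ℝ) ^ α)⁻¹ * ∑ k ∈ Finset.range n, u k ω)
      atTop (𝓝 0) := by
  have hα₀ : 0 < α := by linarith
  have hcompensated := ae_tendsto_inv_rpow_mul_sum_range_of_condExp_eq_zero (μ := μ) (ℱ := ℱ)
    (D := fun n => u n - μ[u n | ℱ n])
    (fun n => (hu n).sub (stronglyMeasurable_condExp.mono (ℱ.mono n.le_succ)))
    (fun n => (hL2 n).sub ((hL2 n).condExp one_le_two))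
    (fun n => condExp_sub_condExp_ae_eq_zero (ℱ.le n) ((hL2 n).integrable one_le_two))
    (fun n => (integral_sub_condExp_sq_le (ℱ.le n) (hL2 n)).trans (hR n)) hα
  have hmean_all : ∀ᵐ ω ∂μ, ∀ n : ℕ, 1 ≤ n → (μ[u n | ℱ n]) ω = (n : ℝ)⁻¹ * Z n ω :=
    ae_all_iff.2 fun n => eventually_imp_distrib_left.2 (hmean n)
  filter_upwards [hcompensated, ae_tendsto_inv_rpow_mul_sum_range_inv_mul hZ hC hα₀ hγα,
    hmean_all] with ω hD hpredictable hω
  have hinv : Tendsto (fun n : ℕ => ((n : ℝ) ^ α)⁻¹) atTop (𝓝 0) :=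
    tendsto_inv_atTop_zero.comp ((tendsto_rpow_atTop hα₀).comp tendsto_natCast_atTop_atTop)
  have hlim := (hD.add hpredictable).add (hinv.mul_const ((μ[u 0 | ℱ 0]) ω))
  rw [zero_mul, add_zero, add_zero] at hlim
  refine hlim.congr' ?_
  filter_upwards [eventually_ge_atTop 1] with n hn
  obtain ⟨m, rfl⟩ := Nat.exists_eq_add_of_le' hn
  have hsplit : ∑ k ∈ Finset.range m, u (k + 1) ω =
      ∑ k ∈ Finset.range m, (u (k + 1) ω - (μ[u (k + 1) | ℱ (k + 1)]) ω) +
        ∑ k ∈ Finset.range m, ((k + 1 : ℕ) : ℝ)⁻¹ * Z (k + 1) ω := by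
    simp only [← Finset.sum_add_distrib, ← hω _ (Nat.succ_pos _), sub_add_cancel]
  simp only [Finset.sum_range_succ', hsplit, Pi.sub_apply, Nat.cast_zero, _root_.inv_zero]
  ring

/-- Conditioning turns the cross term of `(S n + x n) ^ 2` into a multiple of `S n ^ 2`, so the
second moment `v n` of `S n` satisfies `v (n + 1) ≤ (1 + 2 * a / n) * v n + R`. -/
theorem exists_integral_sq_sum_range_le_mul_rpow {x : ℕ → Ω → ℝ} {a R γ : ℝ}
    (hx : ∀ n, StronglyMeasurable[ℱ (n + 1)] (x n)) (hL2 : ∀ n, MemLp (x n) 2 μ)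
    (hR : ∀ n, ∫ ω, x n ω ^ 2 ∂μ ≤ R)
    (hmean : ∀ n : ℕ, 1 ≤ n →
      μ[x n | ℱ n] =ᵐ[μ] fun ω => a / n * ∑ k ∈ Finset.range n, x k ω)
    (hγ : 1 / 2 < γ) (haγ : a < γ) :
    ∃ C : ℝ, 0 ≤ C ∧ ∀ n : ℕ, 1 ≤ n →
      ∫ ω, (∑ k ∈ Finset.range n, x k ω) ^ 2 ∂μ ≤ C * (n : ℝ) ^ (2 * γ) := by
  set v : ℕ → ℝ := fun n => ∫ ω, (∑ k ∈ Finset.range n, x k ω) ^ 2 ∂μ with hv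
  have hsumL2 : ∀ n, MemLp (fun ω => ∑ k ∈ Finset.range n, x k ω) 2 μ := fun n =>
    memLp_finsetSum _ fun k _ => hL2 k
  have hcross : ∀ n : ℕ, 1 ≤ n →
      ∫ ω, (∑ k ∈ Finset.range n, x k ω) * x n ω ∂μ = a / n * v n := fun n hn => by
    rw [integral_mul_eq_integral_mul_condExp (ℱ.le n) (stronglyMeasurable_sum_range_of_succ hx n)
      ((hsumL2 n).integrable_mul (hL2 n)) ((hL2 n).integrable one_le_two), hv,
      ← integral_const_mul]
    refine integral_congr_ae ?_
    filter_upwards [hmean n hn] with ω hω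
    rw [hω]
    ring
  refine exists_le_mul_rpow_of_succ_le (c := 2 * max a 0) (R := R) (by positivity)
    (by linarith [max_lt haγ (by linarith : (0 : ℝ) < γ)]) (by linarith)
    (by simpa [hv] using hR 0) fun n hn => ?_
  calc v (n + 1) = v n + 2 * (a / n * v n) + ∫ ω, x n ω ^ 2 ∂μ := by
        simp only [hv, Finset.sum_range_succ]
        rw [integral_add_sq (hsumL2 n) (hL2 n), hcross n hn]
    _ ≤ v n + 2 * (max a 0 / n * v n) + R := by
        gcongr
        · exact le_max_left a 0
        · exact hR n
    _ = (1 + 2 * max a 0 / n) * v n + R := by ring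

theorem exists_integral_abs_sum_range_le_mul_rpow {x : ℕ → Ω → ℝ} {a R γ : ℝ}
    (hx : ∀ n, StronglyMeasurable[ℱ (n + 1)] (x n)) (hL2 : ∀ n, MemLp (x n) 2 μ)
    (hR : ∀ n, ∫ ω, x n ω ^ 2 ∂μ ≤ R)
    (hmean : ∀ n : ℕ, 1 ≤ n →
      μ[x n | ℱ n] =ᵐ[μ] fun ω => a / n * ∑ k ∈ Finset.range n, x k ω)
    (hγ : 1 / 2 < γ) (haγ : a < γ) :
    ∃ C : ℝ, ∀ n : ℕ, ∫ ω, |∑ k ∈ Finset.range n, x k ω| ∂μ ≤ C * (n : ℝ) ^ γ := by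
  obtain ⟨C, hC₀, hC⟩ := exists_integral_sq_sum_range_le_mul_rpow hx hL2 hR hmean hγ haγ
  refine ⟨√C, fun n => ?_⟩
  rcases n.eq_zero_or_pos with rfl | hn
  · simp only [Finset.sum_range_zero, abs_zero, integral_zero]
    positivity
  calc ∫ ω, |∑ k ∈ Finset.range n, x k ω| ∂μ
      ≤ √(∫ ω, (∑ k ∈ Finset.range n, x k ω) ^ 2 ∂μ) :=
        integral_abs_le_sqrt_integral_sq (memLp_finsetSum _ fun k _ => hL2 k)
    _ ≤ √(C * (n : ℝ) ^ (2 * γ)) := Real.sqrt_le_sqrt (hC n hn)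
    _ = √C * (n : ℝ) ^ γ := by
        rw [Real.sqrt_mul hC₀, mul_comm 2 γ, Real.rpow_mul n.cast_nonneg, Real.rpow_two,
          Real.sqrt_sq (by positivity)]

end ReinforcedSequences

namespace MERW

section Laws

variable {d : ℕ}

/-- The scalar `a` with `E[A_{n+1}] = a • 1`, which governs the growth of the sum of the `X_k`; the
walk is diffusive when it is less than `1 / 2`. -/
noncomputable def meanCoeff (d : ℕ) (p : ℝ) : ℝ := (2 * d * p - 1) / (2 * d - 1)

theorem meanCoeff_lt_half (hd : 1 ≤ d) {p : ℝ} (hp : p < (2 * d + 1) / (4 * d)) :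
    meanCoeff d p < 1 / 2 := by
  have hd₁ : (1 : ℝ) ≤ d := Nat.one_le_cast.2 hd
  rw [lt_div_iff₀ (by linarith)] at hp
  rw [meanCoeff, div_lt_iff₀ (by linarith)]
  linarith

theorem le_one_of_lt_critical (hd : 1 ≤ d) {p : ℝ} (hp : p < (2 * d + 1) / (4 * d)) :
    p ≤ 1 := by
  have hd₁ : (1 : ℝ) ≤ d := Nat.one_le_cast.2 hd
  refine hp.le.trans ?_
  rw [div_le_one (by linarith)]
  linarith

instance : MeasurableSingletonClass (Matrix (Fin d) (Fin d) ℝ) :=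
  inferInstanceAs (MeasurableSingletonClass (Fin d → Fin d → ℝ))

theorem measurable_entry (i j : Fin d) : Measurable fun M : Matrix (Fin d) (Fin d) ℝ => M i j :=
  (measurable_pi_apply j).comp (measurable_pi_apply (X := fun _ : Fin d => Fin d → ℝ) i)

theorem measurable_mulVec {Ω : Type*} [MeasurableSpace Ω] {M : Ω → Matrix (Fin d) (Fin d) ℝ}
    {v : Ω → Fin d → ℝ} (hM : Measurable M) (hv : Measurable v) :
    Measurable fun ω => M ω *ᵥ v ω :=
  measurable_pi_iff.2 fun i => by
    simp only [mulVec, dotProduct]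
    exact Finset.measurable_fun_sum _ fun j _ =>
      ((measurable_entry i j).comp hM).mul ((measurable_pi_apply j).comp hv)

theorem abs_entry_le_one_of_norm_mulVec_le {M : Matrix (Fin d) (Fin d) ℝ}
    (hM : ∀ v, ‖M *ᵥ v‖ ≤ ‖v‖) (i j : Fin d) : |M i j| ≤ 1 := by
  simpa [Pi.norm_single] using (norm_le_pi_norm (M *ᵥ Pi.single j 1) i).trans (hM _)

theorem shiftMatrix_mulVec_apply (v : Fin d → ℝ) (i : Fin d) :
    (shiftMatrix d *ᵥ v) i = v ⟨((i : ℕ) + 1) % d, Nat.mod_lt _ i.pos⟩ := by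
  simp only [mulVec, dotProduct, shiftMatrix, of_apply, ite_mul, one_mul, zero_mul]
  rw [Finset.sum_eq_single_of_mem ⟨((i : ℕ) + 1) % d, Nat.mod_lt _ i.pos⟩ (Finset.mem_univ _)
    fun j _ hj => if_neg fun hij => hj (Fin.ext hij), if_pos rfl]

theorem norm_shiftMatrix_mulVec_le (v : Fin d → ℝ) : ‖shiftMatrix d *ᵥ v‖ ≤ ‖v‖ :=
  (pi_norm_le_iff_of_nonneg (norm_nonneg v)).2 fun i => by
    rw [shiftMatrix_mulVec_apply]
    exact norm_le_pi_norm v _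

theorem norm_shiftMatrix_pow_mulVec_le (k : ℕ) (v : Fin d → ℝ) :
    ‖(shiftMatrix d ^ k) *ᵥ v‖ ≤ ‖v‖ := by
  induction k generalizing v with
  | zero => rw [pow_zero, one_mulVec]
  | succ k ih =>
    rw [pow_succ, ← mulVec_mulVec]
    exact (ih _).trans (norm_shiftMatrix_mulVec_le v)

theorem ae_matrixLaw_norm_mulVec_le (d : ℕ) (p : ℝ) :
    ∀ᵐ M ∂matrixLaw d p, ∀ v : Fin d → ℝ, ‖M *ᵥ v‖ ≤ ‖v‖ := by
  rw [matrixLaw, ae_add_measure_iff]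
  refine ⟨Measure.ae_smul_measure ?_ _, Measure.ae_smul_measure ?_ _⟩
  · simp [ae_dirac_eq]
  · simp only [ae_add_measure_iff, ae_finsetSum_measure_iff, ae_dirac_eq, eventually_pure,
      neg_mulVec, norm_neg, one_mulVec]
    exact ⟨fun v => le_rfl, fun k _ =>
      ⟨norm_shiftMatrix_pow_mulVec_le k, norm_shiftMatrix_pow_mulVec_le k⟩⟩

theorem ae_firstLaw_norm_le (d : ℕ) : ∀ᵐ v ∂firstLaw d, ‖v‖ ≤ 1 := by
  refine Measure.ae_smul_measure (ae_finsetSum_measure_iff.2 fun i _ => ?_) _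
  simp [ae_add_measure_iff, ae_dirac_eq, Pi.norm_single]

/-- The atoms `± J_d ^ k` cancel in pairs, which leaves `p • 1` and the atom at `-1`. -/
theorem integral_entry_matrixLaw (hd : 1 ≤ d) {p : ℝ} (hp₀ : 0 ≤ p) (hp₁ : p ≤ 1)
    (i j : Fin d) :
    ∫ M, M i j ∂matrixLaw d p = meanCoeff d p * (1 : Matrix (Fin d) (Fin d) ℝ) i j := by
  have hd₁ : (1 : ℝ) ≤ d := Nat.one_le_cast.2 hd
  have hd₂ : (2 * d - 1 : ℝ) ≠ 0 := by linarith
  have hq : 0 ≤ (1 - p) / (2 * d - 1) := div_nonneg (by linarith) (by linarith)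
  have hdirac : ∀ N : Matrix (Fin d) (Fin d) ℝ,
      Integrable (fun M : Matrix (Fin d) (Fin d) ℝ => M i j) (Measure.dirac N) := fun N =>
    integrable_dirac' (measurable_entry i j).stronglyMeasurable enorm_lt_top
  have hpair : ∀ k ∈ Finset.Ico 1 d, Integrable (fun M : Matrix (Fin d) (Fin d) ℝ => M i j)
      (Measure.dirac (shiftMatrix d ^ k) + Measure.dirac (-(shiftMatrix d ^ k))) := fun k _ =>
    (hdirac _).add_measure (hdirac _)
  have hpairs := integrable_finsetSum_measure.2 hpair
  rw [matrixLaw, integral_add_measure ((hdirac _).smul_measure ENNReal.ofReal_ne_top)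
      (((hdirac _).add_measure hpairs).smul_measure ENNReal.ofReal_ne_top),
    integral_smul_measure, integral_smul_measure, integral_add_measure (hdirac _) hpairs,
    integral_finsetSum_measure hpair]
  simp only [integral_add_measure (hdirac _) (hdirac _),
    integral_dirac' _ _ (measurable_entry i j).stronglyMeasurable, Matrix.neg_apply,
    add_neg_cancel, Finset.sum_const_zero, add_zero, ENNReal.toReal_ofReal hp₀,
    ENNReal.toReal_ofReal hq, smul_eq_mul, meanCoeff]
  field_simp
  ring

end Laws

variable {Ω : Type*} {d : ℕ} {X₁ : Ω → Fin d → ℝ}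
  {A : ℕ → Ω → Matrix (Fin d) (Fin d) ℝ} {β : ℕ → Ω → ℕ} {Y : ℕ → Ω → ℝ}

section Recursion

theorem X_zero (ω : Ω) : X X₁ A β 0 ω = 0 := by
  rw [X, dir]

theorem X_one (ω : Ω) : X X₁ A β 1 ω = X₁ ω := by
  rw [X, dir]

theorem X_add_two (n : ℕ) (ω : Ω) : X X₁ A β (n + 2) ω =
    if β (n + 1) ω < n + 2 then A (n + 2) ω *ᵥ X X₁ A β (β (n + 1) ω) ω else 0 := by
  simp only [X, dir, dite_eq_ite]

theorem X_succ {n : ℕ} (hn : 1 ≤ n) (ω : Ω) : X X₁ A β (n + 1) ω =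
    ∑ k ∈ Finset.range n, if β n ω = k + 1 then A (n + 1) ω *ᵥ X X₁ A β (k + 1) ω else 0 := by
  obtain ⟨m, rfl⟩ := Nat.exists_eq_add_of_le' hn
  rw [X_add_two]
  rcases β (m + 1) ω with _ | k
  · simp [X_zero]
  · simp only [add_left_inj, Finset.sum_ite_eq, Finset.mem_range, Nat.add_lt_add_iff_right]

/-- The coefficient of the coordinate `j` of `X_k` in `φ(Y_{n+1})` times the coordinate `i` of
`X_{n+1}`, as a function of the innovation `(A_{n+1}, β(n), Y_{n+1})`. The cases
`φ = 1` and `φ = id` describe the steps `X_{n+1}` and `T_{n+1}`. -/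
noncomputable def innovationCoeff (φ : ℝ → ℝ) (i j : Fin d) (k : ℕ)
    (q : Matrix (Fin d) (Fin d) ℝ × ℕ × ℝ) : ℝ :=
  q.1 i j * ((if q.2.1 = k then 1 else 0) * φ q.2.2)

theorem measurable_innovationCoeff {φ : ℝ → ℝ} (hφ : Measurable φ) (i j : Fin d) (k : ℕ) :
    Measurable (innovationCoeff φ i j k) :=
  ((measurable_entry i j).comp measurable_fst).mul
    (((measurable_of_countable fun m : ℕ => if m = k then (1 : ℝ) else 0).comp
      (measurable_fst.comp measurable_snd)).mul (hφ.comp (measurable_snd.comp measurable_snd)))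

theorem mul_X_succ_apply (φ : ℝ → ℝ) {n : ℕ} (hn : 1 ≤ n) (i : Fin d) (ω : Ω) :
    φ (Y (n + 1) ω) * X X₁ A β (n + 1) ω i = ∑ q ∈ Finset.range n ×ˢ Finset.univ,
      innovationCoeff φ i q.2 (q.1 + 1) (A (n + 1) ω, β n ω, Y (n + 1) ω) *
        X X₁ A β (q.1 + 1) ω q.2 := by
  rw [X_succ hn, Finset.sum_apply, Finset.sum_product, Finset.mul_sum]
  refine Finset.sum_congr rfl fun k _ => ?_
  split_ifs with hk
  · simp only [innovationCoeff, if_pos hk, one_mul, mulVec, dotProduct, Finset.mul_sum]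
    exact Finset.sum_congr rfl fun j _ => by ring
  · simp [innovationCoeff, if_neg hk]

theorem S_apply (i : Fin d) (n : ℕ) (ω : Ω) :
    S X₁ A β Y n ω i = ∑ k ∈ Finset.range n, T X₁ A β Y (k + 1) ω i := by
  rw [S, Finset.sum_apply, ← Finset.Ico_add_one_right_eq_Icc, Finset.sum_Ico_eq_sum_range,
    Nat.add_sub_cancel]
  simp only [add_comm]

end Recursion

/-- A generalisation of `IsInput` to random matrices which do not increase the sup norm and have
mean `a • 1`. The law of the first step and those of the step sizes are not prescribed; the sizes
are only required to be bounded in `L²`. -/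
structure IsContractiveInput [MeasurableSpace Ω] (P : Measure Ω) (a : ℝ) (X₁ : Ω → Fin d → ℝ)
    (A : ℕ → Ω → Matrix (Fin d) (Fin d) ℝ) (β : ℕ → Ω → ℕ) (Y : ℕ → Ω → ℝ) : Prop where
  measurable_first : Measurable X₁
  measurable_matrix : ∀ n, 2 ≤ n → Measurable (A n)
  measurable_memory : ∀ n, 1 ≤ n → Measurable (β n)
  measurable_size : ∀ n, 1 ≤ n → Measurable (Y n)
  norm_first_le : ∀ᵐ ω ∂P, ‖X₁ ω‖ ≤ 1
  norm_matrix_mulVec_le : ∀ n, 2 ≤ n → ∀ᵐ ω ∂P, ∀ v, ‖A n ω *ᵥ v‖ ≤ ‖v‖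
  integral_matrix : ∀ n, 2 ≤ n → ∀ i j,
    ∫ ω, A n ω i j ∂P = a * (1 : Matrix (Fin d) (Fin d) ℝ) i j
  law_memory : ∀ n, 1 ≤ n → P.map (β n) = uniformOn (Set.Icc 1 n)
  size_memLp : ∀ n, 1 ≤ n → MemLp (Y n) 2 P
  exists_integral_size_sq_le : ∃ R : ℝ, ∀ n, 1 ≤ n → ∫ ω, Y n ω ^ 2 ∂P ≤ R
  indep_matrix : ∀ n, 1 ≤ n → IndepFun (A (n + 1)) (fun ω => (β n ω, Y (n + 1) ω)) P
  indep_memory_size : ∀ n, 1 ≤ n → IndepFun (β n) (Y (n + 1)) P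
  indep_history : ∀ n, 1 ≤ n →
    IndepFun (fun ω => (A (n + 1) ω, β n ω, Y (n + 1) ω))
      (fun ω (k : Finset.Icc 1 n) => (X X₁ A β k ω, Y k ω)) P

/-- The history `(X_1, Y_1), …, (X_n, Y_n)`, of which the innovation
`(A_{n+1}, β(n), Y_{n+1})` is independent. -/
def history (X₁ : Ω → Fin d → ℝ) (A : ℕ → Ω → Matrix (Fin d) (Fin d) ℝ) (β : ℕ → Ω → ℕ)
    (Y : ℕ → Ω → ℝ) (n : ℕ) (ω : Ω) (k : Finset.Icc 1 n) : (Fin d → ℝ) × ℝ :=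
  (X X₁ A β k ω, Y k ω)

variable [MeasurableSpace Ω] {P : Measure Ω} {p a : ℝ}

theorem IsInput.exists_integral_size_sq_le (h : IsInput P p X₁ A β Y) :
    ∃ R : ℝ, ∀ n, 1 ≤ n → ∫ ω, Y n ω ^ 2 ∂P ≤ R := by
  refine ⟨max (∫ ω, Y 1 ω ^ 2 ∂P) (∫ ω, Y 2 ω ^ 2 ∂P), fun n hn => ?_⟩
  rcases hn.eq_or_lt with rfl | hn
  · exact le_max_left _ _
  · have hident := (h.size_identDistrib n hn).comp (u := fun y : ℝ => y ^ 2)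
      (measurable_id.pow_const 2)
    exact hident.integral_eq.le.trans (le_max_right _ _)

theorem IsInput.isContractiveInput (h : IsInput P p X₁ A β Y) (hd : 1 ≤ d) (hp₀ : 0 ≤ p)
    (hp₁ : p ≤ 1) : IsContractiveInput P (meanCoeff d p) X₁ A β Y where
  measurable_first := h.measurable_first
  measurable_matrix := h.measurable_matrix
  measurable_memory := h.measurable_memory
  measurable_size := h.measurable_size
  norm_first_le := ae_of_ae_map h.measurable_first.aemeasurable
    (h.law_first ▸ ae_firstLaw_norm_le d)
  norm_matrix_mulVec_le n hn := ae_of_ae_map (h.measurable_matrix n hn).aemeasurable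
    (h.law_matrix n hn ▸ ae_matrixLaw_norm_mulVec_le d p)
  integral_matrix n hn i j := by
    rw [← integral_entry_matrixLaw hd hp₀ hp₁, ← h.law_matrix n hn,
      integral_map (h.measurable_matrix n hn).aemeasurable
        (measurable_entry i j).aestronglyMeasurable]
  law_memory := h.law_memory
  size_memLp n hn := by
    rcases hn.eq_or_lt with rfl | hn
    · exact h.first_size_memLp
    · exact h.size_memLp n hn
  exists_integral_size_sq_le := h.exists_integral_size_sq_le
  indep_matrix := h.indep_matrix
  indep_memory_size := h.indep_memory_size
  indep_history := h.indep_history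

namespace IsContractiveInput

theorem measurable_X (h : IsContractiveInput P a X₁ A β Y) (n : ℕ) :
    Measurable (X X₁ A β n) := by
  induction n using Nat.strong_induction_on with
  | _ n ih =>
    match n with
    | 0 => simpa only [funext X_zero] using measurable_const
    | 1 => simpa only [funext X_one] using h.measurable_first
    | n + 2 =>
      simp only [funext (X_succ (Nat.le_add_left 1 n))]
      refine Finset.measurable_fun_sum _ fun k hk => Measurable.ite
        (h.measurable_memory _ (Nat.le_add_left 1 n) (measurableSet_singleton (k + 1)))
        (measurable_mulVec (h.measurable_matrix _ (Nat.le_add_left 2 n)) (ih _ ?_))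
        measurable_const
      exact Nat.succ_lt_succ (Finset.mem_range.1 hk)

theorem ae_norm_X_le (h : IsContractiveInput P a X₁ A β Y) :
    ∀ᵐ ω ∂P, ∀ n, ‖X X₁ A β n ω‖ ≤ 1 := by
  filter_upwards [h.norm_first_le, ae_all_iff.2 fun n =>
    h.norm_matrix_mulVec_le (n + 2) (Nat.le_add_left 2 n)] with ω hfirst hmatrix n
  induction n using Nat.strong_induction_on with
  | _ n ih =>
    match n with
    | 0 => simp [X_zero]
    | 1 => rwa [X_one]
    | n + 2 =>
      rw [X_add_two]
      split_ifs with hlt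
      · exact (hmatrix n _).trans (ih _ hlt)
      · simp

theorem ae_abs_X_apply_le (h : IsContractiveInput P a X₁ A β Y) (n : ℕ) (i : Fin d) :
    ∀ᵐ ω ∂P, |X X₁ A β n ω i| ≤ 1 := by
  filter_upwards [h.ae_norm_X_le] with ω hω
  exact (norm_le_pi_norm _ i).trans (hω n)

theorem measurable_X_apply (h : IsContractiveInput P a X₁ A β Y) (n : ℕ) (i : Fin d) :
    Measurable fun ω => X X₁ A β n ω i :=
  (measurable_pi_apply i).comp (h.measurable_X n)

theorem measurable_history (h : IsContractiveInput P a X₁ A β Y) (n : ℕ) :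
    Measurable (history X₁ A β Y n) :=
  measurable_pi_iff.2 fun k =>
    (h.measurable_X k).prodMk (h.measurable_size k (Finset.mem_Icc.1 k.2).1)

/-- The filtration generated by the histories, with respect to which the steps minus their
conditional means are martingale differences. -/
def filtration (h : IsContractiveInput P a X₁ A β Y) : Filtration ℕ ‹MeasurableSpace Ω› where
  seq n := MeasurableSpace.comap (history X₁ A β Y n) inferInstance
  mono' m n hmn := by
    have hrestrict : history X₁ A β Y m =
        (fun f (k : Finset.Icc 1 m) => f ⟨k, Finset.Icc_subset_Icc_right hmn k.2⟩) ∘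
          history X₁ A β Y n := rfl
    simp only [hrestrict, ← MeasurableSpace.comap_comp]
    exact MeasurableSpace.comap_mono
      (measurable_pi_iff.2 fun k => measurable_pi_apply _).comap_le
  le' n := (h.measurable_history n).comap_le

theorem measurable_filtration_prodMk (h : IsContractiveInput P a X₁ A β Y) {k n : ℕ}
    (hk : k + 1 ≤ n) : Measurable[h.filtration n] fun ω => (X X₁ A β (k + 1) ω, Y (k + 1) ω) :=
  (measurable_pi_apply (⟨k + 1, Finset.mem_Icc.2 ⟨k.succ_pos, hk⟩⟩ : Finset.Icc 1 n)).comp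
    (comap_measurable (history X₁ A β Y n))

theorem stronglyMeasurable_filtration_X_apply (h : IsContractiveInput P a X₁ A β Y) {k n : ℕ}
    (hk : k + 1 ≤ n) (i : Fin d) :
    StronglyMeasurable[h.filtration n] fun ω => X X₁ A β (k + 1) ω i :=
  ((measurable_pi_apply i).comp
    (measurable_fst.comp (h.measurable_filtration_prodMk hk))).stronglyMeasurable

theorem stronglyMeasurable_filtration_T_apply (h : IsContractiveInput P a X₁ A β Y) {k n : ℕ}
    (hk : k + 1 ≤ n) (i : Fin d) :
    StronglyMeasurable[h.filtration n] fun ω => T X₁ A β Y (k + 1) ω i :=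
  (measurable_snd.comp (h.measurable_filtration_prodMk hk)).stronglyMeasurable.mul
    (h.stronglyMeasurable_filtration_X_apply hk i)

theorem measurable_memory_eq (h : IsContractiveInput P a X₁ A β Y) {n : ℕ} (hn : 1 ≤ n) (k : ℕ) :
    Measurable fun ω => if β n ω = k then (1 : ℝ) else 0 :=
  Measurable.ite (h.measurable_memory n hn (measurableSet_singleton k))
    measurable_const measurable_const

theorem indepFun_memory_eq_size {φ : ℝ → ℝ} {n : ℕ} (h : IsContractiveInput P a X₁ A β Y)
    (hφ : Measurable φ) (hn : 1 ≤ n) (k : ℕ) :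
    IndepFun (fun ω => if β n ω = k then (1 : ℝ) else 0) (fun ω => φ (Y (n + 1) ω)) P :=
  (h.indep_memory_size n hn).comp (φ := fun m => if m = k then (1 : ℝ) else 0)
    (measurable_of_countable _) hφ

theorem indepFun_entry_memory_size {φ : ℝ → ℝ} {n : ℕ} (h : IsContractiveInput P a X₁ A β Y)
    (hφ : Measurable φ) (hn : 1 ≤ n) (i j : Fin d) (k : ℕ) :
    IndepFun (fun ω => A (n + 1) ω i j)
      (fun ω => (if β n ω = k then (1 : ℝ) else 0) * φ (Y (n + 1) ω)) P :=
  (h.indep_matrix n hn).comp (measurable_entry i j)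
    (ψ := fun q : ℕ × ℝ => (if q.1 = k then (1 : ℝ) else 0) * φ q.2)
    (((measurable_of_countable fun m : ℕ => if m = k then (1 : ℝ) else 0).comp
      measurable_fst).mul (hφ.comp measurable_snd))

theorem integral_memory_eq (h : IsContractiveInput P a X₁ A β Y) {n k : ℕ} (hn : 1 ≤ n)
    (hk : k ∈ Finset.Icc 1 n) : ∫ ω, (if β n ω = k then (1 : ℝ) else 0) ∂P = (n : ℝ)⁻¹ := by
  have hunif := uniformOn_apply_finset (s := Finset.Icc 1 n) (t := {k})
  rw [Finset.coe_Icc, Finset.coe_singleton, Finset.inter_singleton_of_mem hk] at hunif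
  rw [← integral_map (f := fun m : ℕ => if m = k then (1 : ℝ) else 0)
    (h.measurable_memory n hn).aemeasurable (measurable_of_countable _).aestronglyMeasurable,
    h.law_memory n hn]
  calc ∫ m, (if m = k then (1 : ℝ) else 0) ∂uniformOn (Set.Icc 1 n)
      = ∫ m, ({k} : Set ℕ).indicator 1 m ∂uniformOn (Set.Icc 1 n) := by
        simp only [Set.indicator_apply, Set.mem_singleton_iff, Pi.one_apply]
    _ = (n : ℝ)⁻¹ := by
        rw [integral_indicator_one (measurableSet_singleton k), measureReal_def, hunif]
        simp

theorem memLp_T_apply (h : IsContractiveInput P a X₁ A β Y) {n : ℕ} (hn : 1 ≤ n) (i : Fin d) :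
    MemLp (fun ω => T X₁ A β Y n ω i) 2 P := by
  refine (h.size_memLp n hn).mono
    ((h.measurable_size n hn).mul (h.measurable_X_apply n i)).aestronglyMeasurable ?_
  filter_upwards [h.ae_abs_X_apply_le n i] with ω hω
  rw [T, Pi.smul_apply, norm_smul]
  exact mul_le_of_le_one_right (norm_nonneg _) hω

theorem integral_T_apply_sq_le (h : IsContractiveInput P a X₁ A β Y) {n : ℕ} (hn : 1 ≤ n)
    (i : Fin d) : ∫ ω, T X₁ A β Y n ω i ^ 2 ∂P ≤ ∫ ω, Y n ω ^ 2 ∂P := by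
  refine integral_mono_ae (h.memLp_T_apply hn i).integrable_sq
    (h.size_memLp n hn).integrable_sq ?_
  filter_upwards [h.ae_abs_X_apply_le n i] with ω hω
  simp only [T, Pi.smul_apply, smul_eq_mul, mul_pow]
  exact mul_le_of_le_one_right (sq_nonneg _) ((sq_le_one_iff_abs_le_one _).2 hω)

variable [IsProbabilityMeasure P]

theorem memLp_X_apply (h : IsContractiveInput P a X₁ A β Y) (n : ℕ) (i : Fin d) (q : ENNReal) :
    MemLp (fun ω => X X₁ A β n ω i) q P :=
  MemLp.of_bound (h.measurable_X_apply n i).aestronglyMeasurable 1 (h.ae_abs_X_apply_le n i)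

theorem integral_X_apply_sq_le (h : IsContractiveInput P a X₁ A β Y) (n : ℕ) (i : Fin d) :
    ∫ ω, X X₁ A β n ω i ^ 2 ∂P ≤ 1 := by
  calc ∫ ω, X X₁ A β n ω i ^ 2 ∂P ≤ ∫ _, (1 : ℝ) ∂P := by
        refine integral_mono_ae (h.memLp_X_apply n i 2).integrable_sq (integrable_const _) ?_
        filter_upwards [h.ae_abs_X_apply_le n i] with ω hω
        exact (sq_le_one_iff_abs_le_one _).2 hω
    _ = 1 := by simp

theorem integrable_entry (h : IsContractiveInput P a X₁ A β Y) {n : ℕ} (hn : 2 ≤ n)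
    (i j : Fin d) : Integrable (fun ω => A n ω i j) P := by
  refine Integrable.of_bound
    ((measurable_entry i j).comp (h.measurable_matrix n hn)).aestronglyMeasurable 1 ?_
  filter_upwards [h.norm_matrix_mulVec_le n hn] with ω hω
  exact abs_entry_le_one_of_norm_mulVec_le hω i j

section Innovation

variable {φ : ℝ → ℝ} {n k : ℕ}

theorem integrable_memory_eq (h : IsContractiveInput P a X₁ A β Y) (hn : 1 ≤ n) (k : ℕ) :
    Integrable (fun ω => if β n ω = k then (1 : ℝ) else 0) P :=
  Integrable.of_bound (h.measurable_memory_eq hn k).aestronglyMeasurable 1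
    (ae_of_all _ fun ω => by split_ifs <;> simp)

theorem integrable_innovationCoeff (h : IsContractiveInput P a X₁ A β Y) (hφ : Measurable φ)
    (hφY : Integrable (fun ω => φ (Y (n + 1) ω)) P) (hn : 1 ≤ n) (i j : Fin d) (k : ℕ) :
    Integrable (fun ω => innovationCoeff φ i j k (A (n + 1) ω, β n ω, Y (n + 1) ω)) P :=
  (h.indepFun_entry_memory_size hφ hn i j k).integrable_mul
    (h.integrable_entry (Nat.succ_le_succ hn) i j)
    ((h.indepFun_memory_eq_size hφ hn k).integrable_mul (h.integrable_memory_eq hn k) hφY)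

theorem integral_innovationCoeff (h : IsContractiveInput P a X₁ A β Y) (hφ : Measurable φ)
    (hφY : Integrable (fun ω => φ (Y (n + 1) ω)) P) (hn : 1 ≤ n) (i j : Fin d)
    (hk : k ∈ Finset.Icc 1 n) :
    ∫ ω, innovationCoeff φ i j k (A (n + 1) ω, β n ω, Y (n + 1) ω) ∂P =
      a / n * (∫ ω, φ (Y (n + 1) ω) ∂P) * (1 : Matrix (Fin d) (Fin d) ℝ) i j := by
  have hmemory := h.integrable_memory_eq hn k
  have hindep := h.indepFun_memory_eq_size hφ hn k
  simp only [innovationCoeff]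
  rw [(h.indepFun_entry_memory_size hφ hn i j k).integral_fun_mul_eq_mul_integral
      (h.integrable_entry (Nat.succ_le_succ hn) i j).1 (hindep.integrable_mul hmemory hφY).1,
    hindep.integral_fun_mul_eq_mul_integral hmemory.1 hφY.1,
    h.integral_matrix _ (Nat.succ_le_succ hn), h.integral_memory_eq hn hk]
  ring

theorem condExp_mul_X_succ_apply (h : IsContractiveInput P a X₁ A β Y) (hφ : Measurable φ)
    (hφY : Integrable (fun ω => φ (Y (n + 1) ω)) P) (hn : 1 ≤ n) (i : Fin d) :
    P[fun ω => φ (Y (n + 1) ω) * X X₁ A β (n + 1) ω i | h.filtration n] =ᵐ[P] fun ω =>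
      a / n * (∫ ω', φ (Y (n + 1) ω') ∂P) * ∑ k ∈ Finset.range n, X X₁ A β (k + 1) ω i := by
  set ξ : Ω → Matrix (Fin d) (Fin d) ℝ × ℕ × ℝ := fun ω => (A (n + 1) ω, β n ω, Y (n + 1) ω)
  have hξ : Measurable ξ := (h.measurable_matrix _ (Nat.succ_le_succ hn)).prodMk
    ((h.measurable_memory n hn).prodMk (h.measurable_size _ n.succ_pos))
  have hexpand : (fun ω => φ (Y (n + 1) ω) * X X₁ A β (n + 1) ω i) =
      ∑ q ∈ Finset.range n ×ˢ Finset.univ,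
        (innovationCoeff φ i q.2 (q.1 + 1) ∘ ξ) * fun ω => X X₁ A β (q.1 + 1) ω q.2 := by
    ext ω
    rw [Finset.sum_apply]
    exact mul_X_succ_apply φ hn i ω
  have hlt : ∀ q ∈ Finset.range n ×ˢ (Finset.univ : Finset (Fin d)), q.1 + 1 ≤ n := fun q hq =>
    Finset.mem_range.1 (Finset.mem_product.1 hq).1
  rw [hexpand]
  filter_upwards [condExp_sum_mul_of_indep hξ.comap_le (h.filtration.le n) (h.indep_history n hn) _
    (fun q _ => ((measurable_innovationCoeff hφ i q.2 (q.1 + 1)).comp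
      (comap_measurable ξ)).stronglyMeasurable)
    (fun q _ => h.integrable_innovationCoeff hφ hφY hn i q.2 (q.1 + 1))
    (fun q hq => h.stronglyMeasurable_filtration_X_apply (hlt q hq) q.2)
    (fun q _ => (h.memLp_X_apply (q.1 + 1) q.2 1).integrable le_rfl)] with ω hω
  rw [hω, Finset.sum_product, Finset.mul_sum]
  refine Finset.sum_congr rfl fun k hk => ?_
  have hk' : k + 1 ∈ Finset.Icc 1 n := Finset.mem_Icc.2 ⟨k.succ_pos, Finset.mem_range.1 hk⟩
  simp only [ξ, Function.comp_apply, h.integral_innovationCoeff hφ hφY hn i _ hk', Matrix.one_apply,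
    mul_ite, mul_one, mul_zero, ite_mul, zero_mul, Finset.sum_ite_eq, Finset.mem_univ, if_true]

theorem condExp_X_succ_apply (h : IsContractiveInput P a X₁ A β Y) (hn : 1 ≤ n) (i : Fin d) :
    P[fun ω => X X₁ A β (n + 1) ω i | h.filtration n] =ᵐ[P] fun ω =>
      a / n * ∑ k ∈ Finset.range n, X X₁ A β (k + 1) ω i := by
  simpa using h.condExp_mul_X_succ_apply (φ := fun _ => 1) measurable_const
    (integrable_const _) hn i

theorem condExp_T_succ_apply (h : IsContractiveInput P a X₁ A β Y) (hn : 1 ≤ n) (i : Fin d) :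
    P[fun ω => T X₁ A β Y (n + 1) ω i | h.filtration n] =ᵐ[P] fun ω =>
      a / n * (∫ ω', Y (n + 1) ω' ∂P) * ∑ k ∈ Finset.range n, X X₁ A β (k + 1) ω i :=
  h.condExp_mul_X_succ_apply measurable_id
    ((h.size_memLp _ n.succ_pos).integrable one_le_two) hn i

end Innovation

theorem exists_integral_abs_sum_X_apply_le (h : IsContractiveInput P a X₁ A β Y) (i : Fin d)
    {γ : ℝ} (hγ : 1 / 2 < γ) (haγ : a < γ) :
    ∃ C : ℝ, ∀ n : ℕ,
      ∫ ω, |∑ k ∈ Finset.range n, X X₁ A β (k + 1) ω i| ∂P ≤ C * (n : ℝ) ^ γ :=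
  exists_integral_abs_sum_range_le_mul_rpow
    (fun _ => h.stronglyMeasurable_filtration_X_apply le_rfl i)
    (fun n => h.memLp_X_apply (n + 1) i 2) (fun n => h.integral_X_apply_sq_le (n + 1) i)
    (fun _ hn => h.condExp_X_succ_apply hn i) hγ haγ

theorem abs_integral_size_le_sqrt (h : IsContractiveInput P a X₁ A β Y) {n : ℕ} (hn : 1 ≤ n)
    {R : ℝ} (hR : ∫ ω, Y n ω ^ 2 ∂P ≤ R) : |∫ ω, Y n ω ∂P| ≤ √R :=
  abs_integral_le_integral_abs.trans <|
    (integral_abs_le_sqrt_integral_sq (h.size_memLp n hn)).trans (Real.sqrt_le_sqrt hR)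

theorem ae_tendsto_S_apply (h : IsContractiveInput P a X₁ A β Y) (i : Fin d) {α : ℝ}
    (hα : 1 / 2 < α) (haα : a < α) :
    ∀ᵐ ω ∂P, Tendsto (fun n : ℕ => ((n : ℝ) ^ α)⁻¹ * S X₁ A β Y n ω i) atTop (𝓝 0) := by
  obtain ⟨γ, hγ, hγα⟩ := exists_between (max_lt hα haα)
  obtain ⟨hγ_half, haγ⟩ := max_lt_iff.1 hγ
  obtain ⟨C, hC⟩ := h.exists_integral_abs_sum_X_apply_le i hγ_half haγ
  obtain ⟨R, hR⟩ := h.exists_integral_size_sq_le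
  simp only [S_apply]
  refine ae_tendsto_inv_rpow_mul_sum_range_of_condExp_eq_inv_mul (ℱ := h.filtration) (γ := γ)
    (C := |a| * √R * C)
    (Z := fun n ω => a * (∫ ω', Y (n + 1) ω' ∂P) * ∑ k ∈ Finset.range n, X X₁ A β (k + 1) ω i)
    (fun _ => h.stronglyMeasurable_filtration_T_apply le_rfl i)
    (fun n => h.memLp_T_apply n.succ_pos i)
    (fun n => (h.integral_T_apply_sq_le n.succ_pos i).trans (hR _ n.succ_pos))
    (fun n => (integrable_finsetSum _ fun k _ =>
      (h.memLp_X_apply (k + 1) i 1).integrable le_rfl).const_mul _)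
    (fun n => ?_) (fun n hn => ?_) hα hγα
  · simp only [abs_mul, integral_const_mul]
    calc |a| * |∫ ω, Y (n + 1) ω ∂P| *
          ∫ ω, |∑ k ∈ Finset.range n, X X₁ A β (k + 1) ω i| ∂P
        ≤ |a| * √R * (C * (n : ℝ) ^ γ) := by
          gcongr
          · exact h.abs_integral_size_le_sqrt n.succ_pos (hR _ n.succ_pos)
          · exact hC n
      _ = |a| * √R * C * (n : ℝ) ^ γ := by ring
  · filter_upwards [h.condExp_T_succ_apply hn i] with ω hω
    rw [hω]
    ring

end IsContractiveInput

end MERW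

theorem mainTheorem9_general {Ω : Type*} [MeasurableSpace Ω] {P : Measure Ω}
    [IsProbabilityMeasure P] {d : ℕ} {a : ℝ} {X₁ : Ω → Fin d → ℝ}
    {A : ℕ → Ω → Matrix (Fin d) (Fin d) ℝ} {β : ℕ → Ω → ℕ} {Y : ℕ → Ω → ℝ}
    (h : MERW.IsContractiveInput P a X₁ A β Y) {α : ℝ} (hα : 1 / 2 < α) (haα : a < α) :
    ∀ᵐ ω ∂P, Tendsto (fun n : ℕ => ((n : ℝ) ^ α)⁻¹ • MERW.S X₁ A β Y n ω) atTop (𝓝 0) := by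
  filter_upwards [ae_all_iff.2 fun i => h.ae_tendsto_S_apply i hα haα] with ω hω
  exact tendsto_pi_nhds.2 hω

theorem mainTheorem9 {Ω : Type*} [MeasurableSpace Ω] (P : Measure Ω) [IsProbabilityMeasure P]
    (d : ℕ) (hd : 1 ≤ d) (p : ℝ) (hp₀ : 0 ≤ p) (hp₁ : p < (2 * d + 1) / (4 * d))
    (X₁ : Ω → Fin d → ℝ) (A : ℕ → Ω → Matrix (Fin d) (Fin d) ℝ) (β : ℕ → Ω → ℕ) (Y : ℕ → Ω → ℝ)
    (h : MERW.IsInput P p X₁ A β Y) (α : ℝ) (hα : 1 / 2 < α) :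
    ∀ᵐ ω ∂P, Tendsto (fun n : ℕ => ((n : ℝ) ^ α)⁻¹ • MERW.S X₁ A β Y n ω) atTop (𝓝 0) := by
  exact mainTheorem9_general
    (h.isContractiveInput hd hp₀ (MERW.le_one_of_lt_critical hd hp₁)) hα
    ((MERW.meanCoeff_lt_half hd hp₁).trans hα)
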